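/- Let $\mu=\dfrac{59729}{19885499729}$ and $c=\dfrac{149896229}{10}\sqrt{\dfrac{1495978707}{3317816087784734}}\approx 10065.3$ (the Earth–Sun values). For $(\xi,\eta)\in\mathbb R^2$ put $\rho=\sqrt{\xi^2+\eta^2}$, $\rho_1=\sqrt{(\xi+\mu)^2+\eta^2}$, $\rho_2=\sqrt{(\xi+\mu-1)^2+\eta^2}$, and let $$w_0=\tfrac12(\xi^2+\eta^2)+\frac{1-\mu}{\rho_1}+\frac{\mu}{\rho_2},\qquad Q=\dot\xi^2+\dot\eta^2+2(\dot\eta\,\xi-\dot\xi\,\eta)+\rho^2,$$ $$\begin{aligned}w_1={}&-\tfrac32\bigl(1-\tfrac13\mu(1-\mu)\bigr)\rho^2+\tfrac18Q^2+\tfrac32\Bigl(\frac{1-\mu}{\rho_1}+\frac{\mu}{\rho_2}\Bigr)Q-\tfrac12\Bigl(\frac{(1-\mu)^2}{\rho_1^2}+\frac{\mu^2}{\rho_2^2}\Bigr)\\&+\mu(1-\mu)\Bigl[\bigl(4\dot\eta+\tfrac72\xi\bigr)\Bigl(\frac1{\rho_1}-\frac1{\rho_2}\Bigr)-\tfrac12\eta^2\Bigl(\frac{\mu}{\rho_1^3}+\frac{1-\mu}{\rho_2^3}\Bigr)+\frac{3\mu-2}{2\rho_1}-\frac1{\rho_1\rho_2}+\frac{1-3\mu}{2\rho_2}\Bigr],\end{aligned}$$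 and $w=w_0+c^{-2}w_1$, the potential of the post-Newtonian circular restricted three-body problem in rotating coordinates. Let $f=\partial w/\partial\xi$ and $g=\partial w/\partial\eta$, evaluated at $\dot\xi=\dot\eta=0$; the equilibria are the solutions of $f=g=0$. Let $$\begin{aligned} Z_0&=\Bigl(\tfrac{2499985012616009587660193140271}{5\cdot10^{30}},\tfrac{1082531750278361975463116188557}{1.25\cdot10^{30}}\Bigr),\\ P_1&=\Bigl(\tfrac{2499985512616009587660193140271}{5\cdot10^{30}},\tfrac{4330127145451017576343432330693}{5\cdot10^{30}}\Bigr),\\ P_2&=\Bigl(\tfrac{2499984762616009587660193140271}{5\cdot10^{30}},\tfrac{4330127145451017576343432330693}{5\cdot10^{30}}\Bigr),\\ P_3&=\Bigl(\tfrac{2499985512616009587660193140271}{5\cdot10^{30}},\tfrac{2165063356219154276435264800649}{2.5\cdot10^{30}}\Bigr),\\ P_4&=\Bigl(\tfrac{2499984762616009587660193140271}{5\cdot10^{30}},\tfrac{2165063356219154276435264800649}{2.5\cdot10^{30}}\Bigr), \end{aligned}$$ and, for $t\in[0,1]$, $\beta_1(t)=tP_1+(1-t)P_2$, $\beta_2(t)=tP_3+(1-t)P_4$,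 $\beta_3(t)=tP_1+(1-t)P_3$, $\beta_4(t)=tP_2+(1-t)P_4$. Then: 1. The leading decimal digits of $f$ and $g$ at these points are (the dots mean that the expansion is truncated) $$\begin{aligned} f(P_1)&=1.124997\ldots\times10^{-7},& g(P_1)&=1.94854\ldots\times10^{-7},\\ f(P_2)&=-2.22772\ldots\times10^{-13},& g(P_2)&=3.94516\ldots\times10^{-13},\\ f(P_3)&=4.60545\ldots\times10^{-13},& g(P_3)&=-7.63052\ldots\times10^{-13},\\ f(P_4)&=-1.12499\ldots\times10^{-7},& g(P_4)&=-1.94855\ldots\times10^{-7},\\ f(Z_0)&=-1.14508\ldots\times10^{-32},& g(Z_0)&=-4.25190\ldots\times10^{-32}. \end{aligned}$$ 2. $g>0$ on $\beta_1$, $g<0$ on $\beta_2$, $f>0$ on $\beta_3$ and $f<0$ on $\beta_4$. 3. There is a point $P_0$ in the open quadrilateral bounded by $\beta_1,\beta_2,\beta_3,\beta_4$ with $f(P_0)=g(P_0)=0$, and its Euclidean distance to the Newtonian point $L_4=\bigl(\frac{1-2\mu}{2},\frac{\sqrt3}{2}\bigr)$ is less than $10^{-8}$. -/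

import Mathlib

/-! The post-Newtonian circular restricted three-body problem in synodic coordinates `(ξ, η)`, with
mass parameter `μ` and speed of light `c`. Velocities are denoted `dξ`, `dη`. -/

noncomputable section

namespace RelRTBP

/-- Distance `ρ₁` to the primary of mass `1 - μ`, located at `(-μ, 0)`. -/
def rho1 (μ ξ η : ℝ) : ℝ := Real.sqrt ((ξ + μ) ^ 2 + η ^ 2)

/-- Distance `ρ₂` to the primary of mass `μ`, located at `(1 - μ, 0)`. -/
def rho2 (μ ξ η : ℝ) : ℝ := Real.sqrt ((ξ + μ - 1) ^ 2 + η ^ 2)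

/-- Distance `ρ` to the centre of mass. -/
def rho (ξ η : ℝ) : ℝ := Real.sqrt (ξ ^ 2 + η ^ 2)

/-- The Newtonian potential `w₀`. -/
def w0 (μ ξ η : ℝ) : ℝ :=
  1 / 2 * (ξ ^ 2 + η ^ 2) + (1 - μ) / rho1 μ ξ η + μ / rho2 μ ξ η

/-- The first post-Newtonian correction `w₁`. -/
def w1 (μ ξ η dξ dη : ℝ) : ℝ :=
  -(3 / 2) * (1 - 1 / 3 * μ * (1 - μ)) * rho ξ η ^ 2
  + 1 / 8 * (dη ^ 2 + 2 * (dη * ξ - dξ * η) + dξ ^ 2 + rho ξ η ^ 2) ^ 2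
  + 3 / 2 * ((1 - μ) / rho1 μ ξ η + μ / rho2 μ ξ η)
      * (dη ^ 2 + 2 * (dη * ξ - dξ * η) + dξ ^ 2 + rho ξ η ^ 2)
  - 1 / 2 * ((1 - μ) ^ 2 / rho1 μ ξ η ^ 2 + μ ^ 2 / rho2 μ ξ η ^ 2)
  + μ * (1 - μ) *
      ((4 * dη + 7 * ξ / 2) * (1 / rho1 μ ξ η - 1 / rho2 μ ξ η)
        - 1 / 2 * η ^ 2 * (μ / rho1 μ ξ η ^ 3 + (1 - μ) / rho2 μ ξ η ^ 3)
        + ((3 * μ - 2) / (2 * rho1 μ ξ η) - 1 / (rho1 μ ξ η * rho2 μ ξ η)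
            + (1 - 3 * μ) / (2 * rho2 μ ξ η)))

/-- The relativistic potential `w = w₀ + w₁ / c²`. -/
def w (μ c ξ η dξ dη : ℝ) : ℝ := w0 μ ξ η + 1 / c ^ 2 * w1 μ ξ η dξ dη

/-- `∂w/∂ξ` at zero velocity. -/
def fGen (μ c : ℝ) (p : ℝ × ℝ) : ℝ := deriv (fun x => w μ c x p.2 0 0) p.1

/-- `∂w/∂η` at zero velocity. -/
def gGen (μ c : ℝ) (p : ℝ × ℝ) : ℝ := deriv (fun y => w μ c p.1 y 0 0) p.2

/-- The mass parameter of the Earth–Sun system. -/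
def μES : ℝ := 59729 / 19885499729

/-- The speed of light (about `10065.3`) in the units in which the Earth–Sun distance is `1` and
the period is `2π`. -/
def cES : ℝ := 149896229 * Real.sqrt (1495978707 / 3317816087784734) / 10

/-- `f = ∂w/∂ξ` at zero velocity, for the Earth–Sun system. -/
def f (p : ℝ × ℝ) : ℝ := fGen μES cES p

/-- `g = ∂w/∂η` at zero velocity, for the Earth–Sun system. -/
def g (p : ℝ × ℝ) : ℝ := gGen μES cES p

def Z0 : ℝ × ℝ :=
  (2499985012616009587660193140271 / 5000000000000000000000000000000,
   1082531750278361975463116188557 / 1250000000000000000000000000000)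

def P1 : ℝ × ℝ :=
  (2499985512616009587660193140271 / 5000000000000000000000000000000,
   4330127145451017576343432330693 / 5000000000000000000000000000000)

def P2 : ℝ × ℝ :=
  (2499984762616009587660193140271 / 5000000000000000000000000000000,
   4330127145451017576343432330693 / 5000000000000000000000000000000)

def P3 : ℝ × ℝ :=
  (2499985512616009587660193140271 / 5000000000000000000000000000000,
   2165063356219154276435264800649 / 2500000000000000000000000000000)

def P4 : ℝ × ℝ :=
  (2499984762616009587660193140271 / 5000000000000000000000000000000,
   2165063356219154276435264800649 / 2500000000000000000000000000000)

def β1 (t : ℝ) : ℝ × ℝ := t • P1 + (1 - t) • P2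

def β2 (t : ℝ) : ℝ × ℝ := t • P3 + (1 - t) • P4

def β3 (t : ℝ) : ℝ × ℝ := t • P1 + (1 - t) • P3

def β4 (t : ℝ) : ℝ × ℝ := t • P2 + (1 - t) • P4

/-- The open region bounded by the four sides `β1`, `β2`, `β3`, `β4`: the interior of the (convex)
quadrilateral with vertices `P1`, `P2`, `P4`, `P3`. -/
def region : Set (ℝ × ℝ) := interior (convexHull ℝ {P1, P2, P3, P4})

end RelRTBP

end

/-! The pair `(f, g)` is the gradient of the potential at rest. Near `L₄` the mixed derivative
`∂²w/∂ξ∂η` is positive, because its Newtonian part, about `3√3/4`, dominates the correction of order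
`1 / c²`. Hence `f` increases with `η` and `g` with `ξ`, and on an axis-parallel rectangle near `L₄`
the signs of `f` and `g` along all four sides follow from their signs at the top left and the bottom
right vertex. When the gradient points outwards along the sides, a minimum point of `w` over the
rectangle lies in the interior and is an equilibrium; a rectangle with sides of order `10⁻⁹` locates
it. The numerical values come from the fact that `f` and `g` are polynomials in `ξ`, `η`, `1 / ρ₁`
and `1 / ρ₂`: replacing `1 / ρᵢ` by a rational approximation of accuracy `e` changes them by at most
`100 * e`. -/

noncomputable section

namespace RelRTBP

/-! ### Critical points on a rectangle -/

theorem deriv_mul_sub_nonneg_of_isMinOn {φ : ℝ → ℝ} {φ' a b x y : ℝ} (hφ : HasDerivAt φ φ' x)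
    (hx : x ∈ Set.Icc a b) (hy : y ∈ Set.Icc a b) (hmin : IsMinOn φ (Set.Icc a b) x) :
    0 ≤ φ' * (y - x) := by
  have h := hmin.localize.hasFDerivWithinAt_nonneg hφ.hasFDerivAt.hasFDerivWithinAt
    (sub_mem_posTangentConeAt_of_segment_subset ((convex_Icc a b).segment_subset hx hy))
  simpa [mul_comm] using h

theorem mem_Ioo_and_deriv_eq_zero_of_isMinOn {φ : ℝ → ℝ} {φ' a b x : ℝ} (hφ : HasDerivAt φ φ' x)
    (hx : x ∈ Set.Icc a b) (hmin : IsMinOn φ (Set.Icc a b) x) (ha : x = a → φ' < 0)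
    (hb : x = b → 0 < φ') : x ∈ Set.Ioo a b ∧ φ' = 0 := by
  have hab : a ≤ b := hx.1.trans hx.2
  have hxa : a ≠ x := fun h => by
    have hle := deriv_mul_sub_nonneg_of_isMinOn hφ hx (Set.right_mem_Icc.2 hab) hmin
    have hxb : b ≤ x := sub_nonpos.1 (nonpos_of_mul_nonneg_right hle (ha h.symm))
    exact (ha h.symm).not_gt (hb (hx.2.antisymm hxb))
  have hxb : x ≠ b := fun h => by
    have hle := deriv_mul_sub_nonneg_of_isMinOn hφ hx (Set.left_mem_Icc.2 hab) hmin
    exact (sub_nonneg.1 (nonneg_of_mul_nonneg_right hle (hb h))).not_gt (hx.1.lt_of_ne hxa)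
  have hmem : x ∈ Set.Ioo a b := ⟨hx.1.lt_of_ne hxa, hx.2.lt_of_ne hxb⟩
  exact ⟨hmem, (hmin.isLocalMin (Icc_mem_nhds hmem.1 hmem.2)).hasDerivAt_eq_zero hφ⟩

theorem exists_critical_point_of_outward_gradient {W F G : ℝ × ℝ → ℝ} {a b c d : ℝ}
    (hab : a ≤ b) (hcd : c ≤ d)
    (hW : ContinuousOn W (Set.Icc a b ×ˢ Set.Icc c d))
    (hF : ∀ p ∈ Set.Icc a b ×ˢ Set.Icc c d, HasDerivAt (fun x => W (x, p.2)) (F p) p.1)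
    (hG : ∀ p ∈ Set.Icc a b ×ˢ Set.Icc c d, HasDerivAt (fun y => W (p.1, y)) (G p) p.2)
    (hleft : ∀ y ∈ Set.Icc c d, F (a, y) < 0) (hright : ∀ y ∈ Set.Icc c d, 0 < F (b, y))
    (hbot : ∀ x ∈ Set.Icc a b, G (x, c) < 0) (htop : ∀ x ∈ Set.Icc a b, 0 < G (x, d)) :
    ∃ p ∈ Set.Ioo a b ×ˢ Set.Ioo c d, F p = 0 ∧ G p = 0 := by
  obtain ⟨⟨x, y⟩, hp, hmin⟩ := (isCompact_Icc.prod isCompact_Icc).exists_isMinOn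
    ⟨(a, c), Set.left_mem_Icc.2 hab, Set.left_mem_Icc.2 hcd⟩ hW
  have hx : x ∈ Set.Icc a b := hp.1
  have hy : y ∈ Set.Icc c d := hp.2
  obtain ⟨hx', hFp⟩ := mem_Ioo_and_deriv_eq_zero_of_isMinOn (hF _ hp) hx
    (fun s hs => hmin (Set.mk_mem_prod hs hy))
    (fun h : x = a => h ▸ hleft y hy) (fun h : x = b => h ▸ hright y hy)
  obtain ⟨hy', hGp⟩ := mem_Ioo_and_deriv_eq_zero_of_isMinOn (hG _ hp) hy
    (fun s hs => hmin (Set.mk_mem_prod hx hs))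
    (fun h : y = c => h ▸ hbot x hx) (fun h : y = d => h ▸ htop x hx)
  exact ⟨(x, y), ⟨hx', hy'⟩, hFp, hGp⟩

/-! ### The gradient and the mixed second derivative of the potential -/

/-- The potential at rest as a polynomial in `ξ = x`, `η = y`, `u = 1 / ρ₁`, `v = 1 / ρ₂` and
`k = 1 / c²`. -/
def restPotential (μ k x y u v : ℝ) : ℝ :=
  1 / 2 * (x ^ 2 + y ^ 2) + (1 - μ) * u + μ * v +
  k * (-(3 / 2) * (1 - 1 / 3 * μ * (1 - μ)) * (x ^ 2 + y ^ 2) + 1 / 8 * (x ^ 2 + y ^ 2) ^ 2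
    + 3 / 2 * ((1 - μ) * u + μ * v) * (x ^ 2 + y ^ 2)
    - 1 / 2 * ((1 - μ) ^ 2 * u ^ 2 + μ ^ 2 * v ^ 2)
    + μ * (1 - μ) * (7 / 2 * x * (u - v) - 1 / 2 * y ^ 2 * (μ * u ^ 3 + (1 - μ) * v ^ 3)
      + 1 / 2 * (3 * μ - 2) * u - u * v + 1 / 2 * (1 - 3 * μ) * v))

/-- The partial derivative of the potential with respect to `ξ`. -/
def restGradFst (μ k x y u v : ℝ) : ℝ :=
  x - (1 - μ) * (x + μ) * u ^ 3 - μ * (x + μ - 1) * v ^ 3 +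
  k * (-3 * (1 - 1 / 3 * μ * (1 - μ)) * x + 1 / 2 * (x ^ 2 + y ^ 2) * x
    + 3 * ((1 - μ) * u + μ * v) * x
    - 3 / 2 * ((1 - μ) * (x + μ) * u ^ 3 + μ * (x + μ - 1) * v ^ 3) * (x ^ 2 + y ^ 2)
    + ((1 - μ) ^ 2 * (x + μ) * u ^ 4 + μ ^ 2 * (x + μ - 1) * v ^ 4)
    + μ * (1 - μ) * (7 / 2 * (u - v) - 7 / 2 * x * ((x + μ) * u ^ 3 - (x + μ - 1) * v ^ 3)
      + 3 / 2 * y ^ 2 * (μ * (x + μ) * u ^ 5 + (1 - μ) * (x + μ - 1) * v ^ 5)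
      - 1 / 2 * (3 * μ - 2) * (x + μ) * u ^ 3 + (x + μ) * u ^ 3 * v + (x + μ - 1) * u * v ^ 3
      - 1 / 2 * (1 - 3 * μ) * (x + μ - 1) * v ^ 3))

/-- The partial derivative of the potential with respect to `η`. -/
def restGradSnd (μ k x y u v : ℝ) : ℝ :=
  y - (1 - μ) * y * u ^ 3 - μ * y * v ^ 3 +
  k * (-3 * (1 - 1 / 3 * μ * (1 - μ)) * y + 1 / 2 * (x ^ 2 + y ^ 2) * y
    + 3 * ((1 - μ) * u + μ * v) * y
    - 3 / 2 * ((1 - μ) * y * u ^ 3 + μ * y * v ^ 3) * (x ^ 2 + y ^ 2)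
    + ((1 - μ) ^ 2 * y * u ^ 4 + μ ^ 2 * y * v ^ 4)
    + μ * (1 - μ) * (-(7 / 2) * x * y * (u ^ 3 - v ^ 3)
      - y * (μ * u ^ 3 + (1 - μ) * v ^ 3) + 3 / 2 * y ^ 3 * (μ * u ^ 5 + (1 - μ) * v ^ 5)
      - 1 / 2 * (3 * μ - 2) * y * u ^ 3 + y * u ^ 3 * v + y * u * v ^ 3
      - 1 / 2 * (1 - 3 * μ) * y * v ^ 3))

/-- The coefficient of `1 / c²` in the mixed second derivative of the potential. -/
def restMixedCorrection (μ x y u v : ℝ) : ℝ :=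
  x * y - 3 * ((1 - μ) * (x + μ) * y * u ^ 3 + μ * (x + μ - 1) * y * v ^ 3)
  - 3 * x * y * ((1 - μ) * u ^ 3 + μ * v ^ 3)
  + 9 / 2 * (x ^ 2 + y ^ 2) * y * ((1 - μ) * (x + μ) * u ^ 5 + μ * (x + μ - 1) * v ^ 5)
  - 4 * y * ((1 - μ) ^ 2 * (x + μ) * u ^ 6 + μ ^ 2 * (x + μ - 1) * v ^ 6)
  + μ * (1 - μ) * (-(7 / 2) * y * (u ^ 3 - v ^ 3)
    + 21 / 2 * x * y * ((x + μ) * u ^ 5 - (x + μ - 1) * v ^ 5)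
    + 3 * y * (μ * (x + μ) * u ^ 5 + (1 - μ) * (x + μ - 1) * v ^ 5)
    - 15 / 2 * y ^ 3 * (μ * (x + μ) * u ^ 7 + (1 - μ) * (x + μ - 1) * v ^ 7)
    + 3 / 2 * (3 * μ - 2) * (x + μ) * y * u ^ 5
    - 3 * (x + μ) * y * u ^ 5 * v - (x + μ - 1) * y * u ^ 3 * v ^ 3
    - (x + μ) * y * u ^ 3 * v ^ 3 - 3 * (x + μ - 1) * y * u * v ^ 5
    + 3 / 2 * (1 - 3 * μ) * (x + μ - 1) * y * v ^ 5)

/-- The mixed second derivative of the potential. -/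
def restMixed (μ k x y u v : ℝ) : ℝ :=
  3 * (1 - μ) * (x + μ) * y * u ^ 5 + 3 * μ * (x + μ - 1) * y * v ^ 5
  + k * restMixedCorrection μ x y u v

theorem w_rest_eq (μ c x y : ℝ) :
    w μ c x y 0 0 = restPotential μ (1 / c ^ 2) x y (rho1 μ x y)⁻¹ (rho2 μ x y)⁻¹ := by
  have h : rho x y ^ 2 = x ^ 2 + y ^ 2 := Real.sq_sqrt (by positivity)
  simp only [w, w0, w1, restPotential, h, div_eq_mul_inv, mul_inv, inv_pow]
  ring

theorem rho2_eq_rho1 (μ x y : ℝ) : rho2 μ x y = rho1 (μ - 1) x y := by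
  rw [rho1, rho2, add_sub_assoc]

theorem rho1_pos (μ x : ℝ) {y : ℝ} (hy : y ≠ 0) : 0 < rho1 μ x y :=
  Real.sqrt_pos.2 (by positivity)

theorem hasDerivAt_inv_rho1_fst (μ x : ℝ) {y : ℝ} (hy : y ≠ 0) :
    HasDerivAt (fun t => (rho1 μ t y)⁻¹) (-(x + μ) * (rho1 μ x y)⁻¹ ^ 3) x := by
  have hpos := rho1_pos μ x hy
  have h : HasDerivAt (fun t => (t + μ) ^ 2 + y ^ 2) (2 * (x + μ)) x := by
    simpa using (((hasDerivAt_id x).add_const μ).pow 2).add_const (y ^ 2)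
  refine ((h.sqrt (Real.sqrt_pos.1 hpos).ne').inv hpos.ne').congr_deriv ?_
  rw [← rho1]
  field_simp

theorem hasDerivAt_inv_rho1_snd (μ x : ℝ) {y : ℝ} (hy : y ≠ 0) :
    HasDerivAt (fun t => (rho1 μ x t)⁻¹) (-y * (rho1 μ x y)⁻¹ ^ 3) y := by
  have hpos := rho1_pos μ x hy
  have h : HasDerivAt (fun t => (x + μ) ^ 2 + t ^ 2) (2 * y) y := by
    simpa using ((hasDerivAt_id y).pow 2).const_add ((x + μ) ^ 2)
  refine ((h.sqrt (Real.sqrt_pos.1 hpos).ne').inv hpos.ne').congr_deriv ?_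
  rw [← rho1]
  field_simp

theorem hasDerivAt_inv_rho2_fst (μ x : ℝ) {y : ℝ} (hy : y ≠ 0) :
    HasDerivAt (fun t => (rho2 μ t y)⁻¹) (-(x + μ - 1) * (rho2 μ x y)⁻¹ ^ 3) x := by
  simpa only [rho2_eq_rho1, add_sub_assoc] using hasDerivAt_inv_rho1_fst (μ - 1) x hy

theorem hasDerivAt_inv_rho2_snd (μ x : ℝ) {y : ℝ} (hy : y ≠ 0) :
    HasDerivAt (fun t => (rho2 μ x t)⁻¹) (-y * (rho2 μ x y)⁻¹ ^ 3) y := by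
  simpa only [rho2_eq_rho1] using hasDerivAt_inv_rho1_snd (μ - 1) x hy

section Derivatives

variable {μ k : ℝ} {u v : ℝ → ℝ}

theorem hasDerivAt_restPotential_fst {x y : ℝ} (hu : HasDerivAt u (-(x + μ) * u x ^ 3) x)
    (hv : HasDerivAt v (-(x + μ - 1) * v x ^ 3) x) :
    HasDerivAt (fun t => restPotential μ k t y (u t) (v t))
      (restGradFst μ k x y (u x) (v x)) x := by
  have hu' := hu.differentiableAt
  have hv' := hv.differentiableAt
  unfold restPotential
  refine DifferentiableAt.hasDerivAt (by fun_prop) |>.congr_deriv ?_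
  simp (disch := fun_prop) only [deriv_fun_add, deriv_fun_sub, deriv_fun_mul, deriv_fun_pow,
    deriv_const, deriv_const_mul_id, deriv_id'', hu.deriv, hv.deriv, restGradFst]
  ring

theorem hasDerivAt_restPotential_snd {x y : ℝ} (hu : HasDerivAt u (-y * u y ^ 3) y)
    (hv : HasDerivAt v (-y * v y ^ 3) y) :
    HasDerivAt (fun t => restPotential μ k x t (u t) (v t))
      (restGradSnd μ k x y (u y) (v y)) y := by
  have hu' := hu.differentiableAt
  have hv' := hv.differentiableAt
  unfold restPotential
  refine DifferentiableAt.hasDerivAt (by fun_prop) |>.congr_deriv ?_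
  simp (disch := fun_prop) only [deriv_fun_add, deriv_fun_sub, deriv_fun_mul, deriv_fun_pow,
    deriv_const, deriv_id'', hu.deriv, hv.deriv, restGradSnd]
  ring

theorem hasDerivAt_restGradFst_snd {x y : ℝ} (hu : HasDerivAt u (-y * u y ^ 3) y)
    (hv : HasDerivAt v (-y * v y ^ 3) y) :
    HasDerivAt (fun t => restGradFst μ k x t (u t) (v t)) (restMixed μ k x y (u y) (v y)) y := by
  have hu' := hu.differentiableAt
  have hv' := hv.differentiableAt
  unfold restGradFst
  refine DifferentiableAt.hasDerivAt (by fun_prop) |>.congr_deriv ?_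
  simp (disch := fun_prop) only [deriv_fun_add, deriv_fun_sub, deriv_fun_mul, deriv_fun_pow,
    deriv_const, deriv_id'', hu.deriv, hv.deriv, restMixed, restMixedCorrection]
  ring

theorem hasDerivAt_restGradSnd_fst {x y : ℝ} (hu : HasDerivAt u (-(x + μ) * u x ^ 3) x)
    (hv : HasDerivAt v (-(x + μ - 1) * v x ^ 3) x) :
    HasDerivAt (fun t => restGradSnd μ k t y (u t) (v t)) (restMixed μ k x y (u x) (v x)) x := by
  have hu' := hu.differentiableAt
  have hv' := hv.differentiableAt
  unfold restGradSnd
  refine DifferentiableAt.hasDerivAt (by fun_prop) |>.congr_deriv ?_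
  simp (disch := fun_prop) only [deriv_fun_add, deriv_fun_sub, deriv_fun_mul, deriv_fun_pow,
    deriv_const, deriv_const_mul_id, deriv_id'', hu.deriv, hv.deriv, restMixed, restMixedCorrection]
  ring

end Derivatives

theorem hasDerivAt_w_fst (μ c x : ℝ) {y : ℝ} (hy : y ≠ 0) :
    HasDerivAt (fun t => w μ c t y 0 0)
      (restGradFst μ (1 / c ^ 2) x y (rho1 μ x y)⁻¹ (rho2 μ x y)⁻¹) x := by
  simpa only [w_rest_eq] using hasDerivAt_restPotential_fst
    (hasDerivAt_inv_rho1_fst μ x hy) (hasDerivAt_inv_rho2_fst μ x hy)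

theorem hasDerivAt_w_snd (μ c x : ℝ) {y : ℝ} (hy : y ≠ 0) :
    HasDerivAt (fun t => w μ c x t 0 0)
      (restGradSnd μ (1 / c ^ 2) x y (rho1 μ x y)⁻¹ (rho2 μ x y)⁻¹) y := by
  simpa only [w_rest_eq] using hasDerivAt_restPotential_snd
    (hasDerivAt_inv_rho1_snd μ x hy) (hasDerivAt_inv_rho2_snd μ x hy)

theorem fGen_eq (μ c x : ℝ) {y : ℝ} (hy : y ≠ 0) :
    fGen μ c (x, y) = restGradFst μ (1 / c ^ 2) x y (rho1 μ x y)⁻¹ (rho2 μ x y)⁻¹ :=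
  (hasDerivAt_w_fst μ c x hy).deriv

theorem gGen_eq (μ c x : ℝ) {y : ℝ} (hy : y ≠ 0) :
    gGen μ c (x, y) = restGradSnd μ (1 / c ^ 2) x y (rho1 μ x y)⁻¹ (rho2 μ x y)⁻¹ :=
  (hasDerivAt_w_snd μ c x hy).deriv

theorem hasDerivAt_fGen_snd (μ c x : ℝ) {y : ℝ} (hy : y ≠ 0) :
    HasDerivAt (fun t => fGen μ c (x, t))
      (restMixed μ (1 / c ^ 2) x y (rho1 μ x y)⁻¹ (rho2 μ x y)⁻¹) y :=
  (hasDerivAt_restGradFst_snd (hasDerivAt_inv_rho1_snd μ x hy)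
    (hasDerivAt_inv_rho2_snd μ x hy)).congr_of_eventuallyEq
    ((eventually_ne_nhds hy).mono fun _ ht => fGen_eq μ c x ht)

theorem hasDerivAt_gGen_fst (μ c x : ℝ) {y : ℝ} (hy : y ≠ 0) :
    HasDerivAt (fun t => gGen μ c (t, y))
      (restMixed μ (1 / c ^ 2) x y (rho1 μ x y)⁻¹ (rho2 μ x y)⁻¹) x := by
  simpa only [gGen_eq μ c _ hy] using hasDerivAt_restGradSnd_fst
    (hasDerivAt_inv_rho1_fst μ x hy) (hasDerivAt_inv_rho2_fst μ x hy)

theorem continuousOn_w (μ c : ℝ) :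
    ContinuousOn (fun p : ℝ × ℝ => w μ c p.1 p.2 0 0) {p | p.2 ≠ 0} := by
  have hinv (m : ℝ) : ContinuousOn (fun p : ℝ × ℝ => (rho1 m p.1 p.2)⁻¹) {p | p.2 ≠ 0} :=
    ContinuousOn.inv₀ (by unfold rho1; fun_prop) fun p hp => (rho1_pos m p.1 hp).ne'
  have := hinv μ
  have := hinv (μ - 1)
  simp only [w_rest_eq, rho2_eq_rho1, restPotential]
  fun_prop

/-! ### Bounds for polynomial expressions -/

theorem abs_inv_sqrt_sub_le {s a e : ℝ} (hs : 0 < s) (ha : 0 ≤ a + e)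
    (hl : (a - e) ^ 2 * s ≤ 1) (hr : 1 ≤ (a + e) ^ 2 * s) : |(Real.sqrt s)⁻¹ - a| ≤ e := by
  have hlower : a - e ≤ Real.sqrt s⁻¹ :=
    Real.le_sqrt_of_sq_le (by rwa [inv_eq_one_div, le_div_iff₀ hs])
  have hupper : Real.sqrt s⁻¹ ≤ a + e :=
    Real.sqrt_le_iff.2 ⟨ha, by rwa [inv_eq_one_div, div_le_iff₀ hs]⟩
  rw [← Real.sqrt_inv, abs_le]
  constructor <;> linarith

theorem norm_pow_le_of_le {R : Type*} [SeminormedRing R] [NormOneClass R] {a : R} {r : ℝ}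
    (ha : ‖a‖ ≤ r) (n : ℕ) : ‖a ^ n‖ ≤ r ^ n :=
  (norm_pow_le a n).trans (pow_le_pow_left₀ (norm_nonneg a) ha n)

theorem norm_restMixedCorrection_le {μ x y u v : ℝ} (hμ : ‖μ‖ ≤ 1) (hx : ‖x‖ ≤ 1) (hy : ‖y‖ ≤ 1)
    (hu : ‖u‖ ≤ 2) (hv : ‖v‖ ≤ 2) : ‖restMixedCorrection μ x y u v‖ ≤ 10 ^ 6 := by
  unfold restMixedCorrection
  apply le_trans
  · repeat' first
      | assumption
      | apply norm_sub_le_of_le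
      | apply norm_add_le_of_le
      | apply norm_pow_le_of_le
      | apply norm_mul_le_of_le
      | exact le_rfl
  · norm_num

/-- The elements `s`, `t` have norm at most `B` and lie within `L * e` of each other. Keeping the
accuracy `e` of the data separate from the constant `L` makes the constant of a polynomial
expression computable from its shape. -/
structure BoundedClose {R : Type*} [SeminormedRing R] (e B L : ℝ) (s t : R) : Prop where
  norm_left_le : ‖s‖ ≤ B
  norm_right_le : ‖t‖ ≤ B
  norm_sub_le : ‖s - t‖ ≤ L * e

namespace BoundedClose

variable {R : Type*} [SeminormedRing R] {e B B₁ B₂ L L₁ L₂ : ℝ} {s s₁ s₂ t t₁ t₂ : R}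

theorem norm_sub_le_mul (h : BoundedClose e B L s t) (he : 0 ≤ e) (hL : L ≤ L₁) :
    ‖s - t‖ ≤ L₁ * e :=
  h.norm_sub_le.trans (mul_le_mul_of_nonneg_right hL he)

theorem refl (hs : ‖s‖ ≤ B) : BoundedClose e B 0 s s :=
  ⟨hs, hs, by simp⟩

theorem add (h₁ : BoundedClose e B₁ L₁ s₁ t₁) (h₂ : BoundedClose e B₂ L₂ s₂ t₂) :
    BoundedClose e (B₁ + B₂) (L₁ + L₂) (s₁ + s₂) (t₁ + t₂) where
  norm_left_le := norm_add_le_of_le h₁.norm_left_le h₂.norm_left_le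
  norm_right_le := norm_add_le_of_le h₁.norm_right_le h₂.norm_right_le
  norm_sub_le := by
    rw [add_sub_add_comm, add_mul]
    exact norm_add_le_of_le h₁.norm_sub_le h₂.norm_sub_le

theorem sub (h₁ : BoundedClose e B₁ L₁ s₁ t₁) (h₂ : BoundedClose e B₂ L₂ s₂ t₂) :
    BoundedClose e (B₁ + B₂) (L₁ + L₂) (s₁ - s₂) (t₁ - t₂) where
  norm_left_le := norm_sub_le_of_le h₁.norm_left_le h₂.norm_left_le
  norm_right_le := norm_sub_le_of_le h₁.norm_right_le h₂.norm_right_le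
  norm_sub_le := by
    rw [sub_sub_sub_comm, add_mul]
    exact norm_sub_le_of_le h₁.norm_sub_le h₂.norm_sub_le

theorem mul (h₁ : BoundedClose e B₁ L₁ s₁ t₁) (h₂ : BoundedClose e B₂ L₂ s₂ t₂) :
    BoundedClose e (B₁ * B₂) (L₁ * B₂ + B₁ * L₂) (s₁ * s₂) (t₁ * t₂) where
  norm_left_le := norm_mul_le_of_le h₁.norm_left_le h₂.norm_left_le
  norm_right_le := norm_mul_le_of_le h₁.norm_right_le h₂.norm_right_le
  norm_sub_le := by
    calc ‖s₁ * s₂ - t₁ * t₂‖ = ‖(s₁ - t₁) * s₂ + t₁ * (s₂ - t₂)‖ := by noncomm_ring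
      _ ≤ L₁ * e * B₂ + B₁ * (L₂ * e) := norm_add_le_of_le
        (norm_mul_le_of_le h₁.norm_sub_le h₂.norm_left_le)
        (norm_mul_le_of_le h₁.norm_right_le h₂.norm_sub_le)
      _ = (L₁ * B₂ + B₁ * L₂) * e := by ring

theorem pow [NormOneClass R] (h : BoundedClose e B L s t) (n : ℕ) :
    BoundedClose e (B ^ n) (n * B ^ (n - 1) * L) (s ^ n) (t ^ n) := by
  induction n with
  | zero => simpa using refl (e := e) (s := (1 : R)) norm_one.le
  | succ n ih =>
    convert ih.mul h using 1
    · exact pow_succ ..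
    · rcases n with _ | n
      · simp
      · push_cast [add_tsub_cancel_right]
        ring
    · exact pow_succ ..
    · exact pow_succ ..

end BoundedClose

section Lipschitz

variable {μ k x y u v a b e : ℝ}

theorem norm_restGradFst_sub_le (hμ : ‖μ‖ ≤ 1 / 1000) (hk : ‖k‖ ≤ 1 / 1000)
    (hx : ‖x‖ ≤ 1) (hy : ‖y‖ ≤ 1) (hu : BoundedClose e 2 1 u a) (hv : BoundedClose e 2 1 v b) :
    ‖restGradFst μ k x y u v - restGradFst μ k x y a b‖ ≤ 100 * e := by
  have he : 0 ≤ e := by simpa using (norm_nonneg _).trans hu.norm_sub_le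
  unfold restGradFst
  apply BoundedClose.norm_sub_le_mul
  · repeat' first
      | assumption
      | apply BoundedClose.sub
      | apply BoundedClose.add
      | apply BoundedClose.pow
      | apply BoundedClose.mul
      | apply BoundedClose.refl
      | exact le_rfl
  · exact he
  · norm_num

theorem norm_restGradSnd_sub_le (hμ : ‖μ‖ ≤ 1 / 1000) (hk : ‖k‖ ≤ 1 / 1000)
    (hx : ‖x‖ ≤ 1) (hy : ‖y‖ ≤ 1) (hu : BoundedClose e 2 1 u a) (hv : BoundedClose e 2 1 v b) :
    ‖restGradSnd μ k x y u v - restGradSnd μ k x y a b‖ ≤ 100 * e := by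
  have he : 0 ≤ e := by simpa using (norm_nonneg _).trans hu.norm_sub_le
  unfold restGradSnd
  apply BoundedClose.norm_sub_le_mul
  · repeat' first
      | assumption
      | apply BoundedClose.sub
      | apply BoundedClose.add
      | apply BoundedClose.pow
      | apply BoundedClose.mul
      | apply BoundedClose.refl
      | exact le_rfl
  · exact he
  · norm_num

end Lipschitz

/-! ### Monotonicity of the gradient near `L₄` -/

/-- The abscissae of the box around `L₄` in which the mixed second derivative is controlled. -/
def ξRange : Set ℝ := Set.Icc 0.4999 0.5001

/-- The ordinates of the box around `L₄` in which the mixed second derivative is controlled. -/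
def ηRange : Set ℝ := Set.Icc 0.866 0.8661

theorem pos_of_mem_ηRange {y : ℝ} (hy : y ∈ ηRange) : 0 < y :=
  lt_of_lt_of_le (by norm_num) hy.1

theorem restMixed_pos {μ k x y u v : ℝ} (hμ : μ ∈ Set.Icc 0 (1 / 10 ^ 5))
    (hk : k ∈ Set.Icc 0 (1 / 10 ^ 7)) (hx : x ∈ ξRange) (hy : y ∈ ηRange)
    (hu : |u - 1| ≤ 1 / 100) (hv : |v - 1| ≤ 1 / 100) : 0 < restMixed μ k x y u v := by
  obtain ⟨hμ0, hμ1⟩ := hμ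
  obtain ⟨hx0, hx1⟩ := hx
  obtain ⟨hy0, hy1⟩ := hy
  rw [abs_le] at hu hv
  norm_num at hμ1 hx0 hx1 hy0 hy1 hu hv
  have hsun_mass : 0 ≤ 1 - μ := by linarith
  have : 0 ≤ x + μ := by linarith
  have : 0 ≤ y := by linarith
  have hv_nonneg : 0 ≤ v := by linarith
  have hlarge : 1 ≤ 3 * (1 - μ) * (x + μ) * y * u ^ 5 :=
    calc (1 : ℝ) ≤ 3 * 0.9 * 0.49 * 0.86 * 0.99 ^ 5 := by norm_num
      _ ≤ 3 * (1 - μ) * (x + μ) * y * u ^ 5 := by gcongr <;> linarith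
  have hsmall : 3 * μ * (1 - x - μ) * y * v ^ 5 ≤ 1 / 10 :=
    calc 3 * μ * (1 - x - μ) * y * v ^ 5
      _ ≤ 3 * (1 / 10 ^ 5) * 1 * 1 * (1.01 : ℝ) ^ 5 := by gcongr <;> linarith
      _ ≤ 1 / 10 := by norm_num
  have hcorrection : |k * restMixedCorrection μ x y u v| ≤ 1 / 10 :=
    calc |k * restMixedCorrection μ x y u v|
      _ ≤ 1 / 10 ^ 7 * 10 ^ 6 := norm_mul_le_of_le (abs_le.2 ⟨by linarith [hk.1], hk.2⟩) <|
        norm_restMixedCorrection_le (abs_le.2 ⟨by linarith, by linarith⟩)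
          (abs_le.2 ⟨by linarith, by linarith⟩) (abs_le.2 ⟨by linarith, by linarith⟩)
          (abs_le.2 ⟨by linarith, by linarith⟩) (abs_le.2 ⟨by linarith, by linarith⟩)
      _ = 1 / 10 := by norm_num
  rw [restMixed]
  linarith [(abs_le.1 hcorrection).1]

theorem restMixed_inv_rho_pos {μ k x y : ℝ} (hμ : μ ∈ Set.Icc 0 (1 / 10 ^ 5))
    (hk : k ∈ Set.Icc 0 (1 / 10 ^ 7)) (hx : x ∈ ξRange) (hy : y ∈ ηRange) :
    0 < restMixed μ k x y (rho1 μ x y)⁻¹ (rho2 μ x y)⁻¹ := by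
  refine restMixed_pos hμ hk hx hy ?_ ?_
  all_goals
    obtain ⟨hμ0, hμ1⟩ := hμ
    obtain ⟨hx0, hx1⟩ := hx
    obtain ⟨hy0, hy1⟩ := hy
    apply abs_inv_sqrt_sub_le <;> nlinarith

theorem strictMonoOn_fGen_snd {μ c x : ℝ} (hμ : μ ∈ Set.Icc 0 (1 / 10 ^ 5))
    (hc : 1 / c ^ 2 ≤ 1 / 10 ^ 7) (hx : x ∈ ξRange) :
    StrictMonoOn (fun y => fGen μ c (x, y)) ηRange := by
  have hderiv (y : ℝ) (hy : y ∈ ηRange) := hasDerivAt_fGen_snd μ c x (pos_of_mem_ηRange hy).ne'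
  refine strictMonoOn_of_deriv_pos (convex_Icc _ _)
    (fun y hy => (hderiv y hy).continuousAt.continuousWithinAt) fun y hy => ?_
  have hy' := interior_subset hy
  rw [(hderiv y hy').deriv]
  exact restMixed_inv_rho_pos hμ ⟨by positivity, hc⟩ hx hy'

theorem strictMonoOn_gGen_fst {μ c y : ℝ} (hμ : μ ∈ Set.Icc 0 (1 / 10 ^ 5))
    (hc : 1 / c ^ 2 ≤ 1 / 10 ^ 7) (hy : y ∈ ηRange) :
    StrictMonoOn (fun x => gGen μ c (x, y)) ξRange := by
  have hderiv (x : ℝ) := hasDerivAt_gGen_fst μ c x (pos_of_mem_ηRange hy).ne'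
  refine strictMonoOn_of_deriv_pos (convex_Icc _ _)
    (fun x _ => (hderiv x).continuousAt.continuousWithinAt) fun x hx => ?_
  rw [(hderiv x).deriv]
  exact restMixed_inv_rho_pos hμ ⟨by positivity, hc⟩ (interior_subset hx) hy

/-! ### Rectangles with outward gradient -/

/-- A rectangle near `L₄` with top left vertex `p` and bottom right vertex `q`, where the signs of
the gradient `(f, g)` are prescribed at these two vertices. Since `f` increases with the ordinate
and `g` with the abscissa, this makes the gradient point outwards along all four sides. -/
structure OutwardRectangle (p q : ℝ × ℝ) : Prop where
  topLeft_mem : p ∈ ξRange ×ˢ ηRange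
  bottomRight_mem : q ∈ ξRange ×ˢ ηRange
  fst_le : p.1 ≤ q.1
  snd_le : q.2 ≤ p.2
  f_topLeft_neg : f p < 0
  g_topLeft_pos : 0 < g p
  f_bottomRight_pos : 0 < f q
  g_bottomRight_neg : g q < 0

/-- The value of `1 / c²` for the Earth–Sun system. -/
def kES : ℝ := 331781608778473400 / (149896229 ^ 2 * 1495978707)

theorem one_div_cES_sq : 1 / cES ^ 2 = kES := by
  rw [cES, kES, div_pow, mul_pow, Real.sq_sqrt (by norm_num)]
  norm_num

theorem strictMonoOn_f_snd {x : ℝ} (hx : x ∈ ξRange) :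
    StrictMonoOn (fun y => f (x, y)) ηRange :=
  strictMonoOn_fGen_snd (by norm_num [μES]) (one_div_cES_sq.trans_le (by norm_num [kES])) hx

theorem strictMonoOn_g_fst {y : ℝ} (hy : y ∈ ηRange) :
    StrictMonoOn (fun x => g (x, y)) ξRange :=
  strictMonoOn_gGen_fst (by norm_num [μES]) (one_div_cES_sq.trans_le (by norm_num [kES])) hy

namespace OutwardRectangle

variable {p q : ℝ × ℝ} {x y : ℝ}

theorem fst_mem (h : OutwardRectangle p q) (hx : x ∈ Set.Icc p.1 q.1) : x ∈ ξRange :=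
  ⟨h.topLeft_mem.1.1.trans hx.1, hx.2.trans h.bottomRight_mem.1.2⟩

theorem snd_mem (h : OutwardRectangle p q) (hy : y ∈ Set.Icc q.2 p.2) : y ∈ ηRange :=
  ⟨h.bottomRight_mem.2.1.trans hy.1, hy.2.trans h.topLeft_mem.2.2⟩

theorem f_left_neg (h : OutwardRectangle p q) (hy : y ∈ Set.Icc q.2 p.2) : f (p.1, y) < 0 :=
  ((strictMonoOn_f_snd h.topLeft_mem.1).monotoneOn (h.snd_mem hy) h.topLeft_mem.2 hy.2).trans_lt
    h.f_topLeft_neg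

theorem f_right_pos (h : OutwardRectangle p q) (hy : y ∈ Set.Icc q.2 p.2) : 0 < f (q.1, y) :=
  h.f_bottomRight_pos.trans_le
    ((strictMonoOn_f_snd h.bottomRight_mem.1).monotoneOn h.bottomRight_mem.2 (h.snd_mem hy) hy.1)

theorem g_bottom_neg (h : OutwardRectangle p q) (hx : x ∈ Set.Icc p.1 q.1) : g (x, q.2) < 0 :=
  ((strictMonoOn_g_fst h.bottomRight_mem.2).monotoneOn (h.fst_mem hx) h.bottomRight_mem.1
    hx.2).trans_lt h.g_bottomRight_neg

theorem g_top_pos (h : OutwardRectangle p q) (hx : x ∈ Set.Icc p.1 q.1) : 0 < g (x, p.2) :=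
  h.g_topLeft_pos.trans_le
    ((strictMonoOn_g_fst h.topLeft_mem.2).monotoneOn h.topLeft_mem.1 (h.fst_mem hx) hx.1)

theorem exists_equilibrium (h : OutwardRectangle p q) :
    ∃ P ∈ Set.Ioo p.1 q.1 ×ˢ Set.Ioo q.2 p.2, f P = 0 ∧ g P = 0 := by
  have hne : ∀ P ∈ Set.Icc p.1 q.1 ×ˢ Set.Icc q.2 p.2, P.2 ≠ 0 := fun P hP =>
    (pos_of_mem_ηRange (h.snd_mem hP.2)).ne'
  exact exists_critical_point_of_outward_gradient h.fst_le h.snd_le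
    ((continuousOn_w μES cES).mono hne)
    (fun P hP => (hasDerivAt_w_fst μES cES P.1 (hne P hP)).differentiableAt.hasDerivAt)
    (fun P hP => (hasDerivAt_w_snd μES cES P.1 (hne P hP)).differentiableAt.hasDerivAt)
    (fun _ => h.f_left_neg) (fun _ => h.f_right_pos)
    (fun _ => h.g_bottom_neg) (fun _ => h.g_top_pos)

end OutwardRectangle

/-! ### Enclosures of the gradient -/

theorem boundedClose_inv_sqrt {s a e : ℝ} (hs : 0 < s) (ha : a ∈ Set.Icc 0 (3 / 2))
    (he : e ∈ Set.Icc 0 (1 / 2)) (hl : (a - e) ^ 2 * s ≤ 1) (hr : 1 ≤ (a + e) ^ 2 * s) :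
    BoundedClose e 2 1 (Real.sqrt s)⁻¹ a := by
  have hclose := abs_inv_sqrt_sub_le hs (add_nonneg ha.1 he.1) hl hr
  have h := abs_le.1 hclose
  exact ⟨abs_le.2 ⟨by linarith [ha.1, he.2], by linarith [ha.2, he.2]⟩,
    abs_le.2 ⟨by linarith [ha.1], by linarith [ha.2]⟩, hclose.trans_eq (one_mul e).symm⟩

theorem fGen_gGen_mem_Ioo {μ c k x y a b e F₁ F₂ G₁ G₂ : ℝ} (hc : 1 / c ^ 2 = k)
    (hμ : ‖μ‖ ≤ 1 / 1000) (hk : ‖k‖ ≤ 1 / 1000) (hx : ‖x‖ ≤ 1) (hy0 : 0 < y) (hy1 : y ≤ 1)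
    (he : e ∈ Set.Icc 0 (1 / 2)) (ha : a ∈ Set.Icc 0 (3 / 2)) (hb : b ∈ Set.Icc 0 (3 / 2))
    (hal : (a - e) ^ 2 * ((x + μ) ^ 2 + y ^ 2) ≤ 1) (har : 1 ≤ (a + e) ^ 2 * ((x + μ) ^ 2 + y ^ 2))
    (hbl : (b - e) ^ 2 * ((x + μ - 1) ^ 2 + y ^ 2) ≤ 1)
    (hbr : 1 ≤ (b + e) ^ 2 * ((x + μ - 1) ^ 2 + y ^ 2))
    (hF : restGradFst μ k x y a b ∈ Set.Ioo (F₁ + 100 * e) (F₂ - 100 * e))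
    (hG : restGradSnd μ k x y a b ∈ Set.Ioo (G₁ + 100 * e) (G₂ - 100 * e)) :
    fGen μ c (x, y) ∈ Set.Ioo F₁ F₂ ∧ gGen μ c (x, y) ∈ Set.Ioo G₁ G₂ := by
  have hy : ‖y‖ ≤ 1 := abs_le.2 ⟨by linarith, hy1⟩
  have hu : BoundedClose e 2 1 (rho1 μ x y)⁻¹ a :=
    boundedClose_inv_sqrt (by positivity) ha he hal har
  have hv : BoundedClose e 2 1 (rho2 μ x y)⁻¹ b :=
    boundedClose_inv_sqrt (by positivity) hb he hbl hbr
  rw [fGen_eq μ c x hy0.ne', gGen_eq μ c x hy0.ne', hc]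
  have hF' := abs_le.1 (norm_restGradFst_sub_le hμ hk hx hy hu hv)
  have hG' := abs_le.1 (norm_restGradSnd_sub_le hμ hk hx hy hu hv)
  exact ⟨⟨by linarith [hF.1], by linarith [hF.2]⟩, ⟨by linarith [hG.1], by linarith [hG.2]⟩⟩

/-- The top left vertex of a rectangle around the equilibrium that is much smaller than the one with
vertices `P1`, …, `P4`. Near `L₄` the Hessian of the potential is close to `3 / 4` times
`!![1, √3; √3, 3]`, so the signs required in `OutwardRectangle` force the ratio of height to width
to be close to `1 / √3`. -/
def Q2 : ℝ × ℝ := (0.4999970015232019, 0.86602540080003958)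

/-- The bottom right vertex of the rectangle with top left vertex `Q2`. -/
def Q3 : ℝ × ℝ := (0.4999970035232019, 0.86602539964533958)

-- The `a` and `b` below are decimal approximations of `1 / ρ₁` and `1 / ρ₂` with error at most `e`.

theorem f_g_P1_mem_Ioo : f P1 ∈ Set.Ioo (1.124997 / 10 ^ 7 : ℝ) (1.124998 / 10 ^ 7) ∧
    g P1 ∈ Set.Ioo (1.94854 / 10 ^ 7 : ℝ) (1.94855 / 10 ^ 7) := by
  apply fGen_gGen_mem_Ioo one_div_cES_sq (a := 999999925000009507029379 / 10 ^ 24)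
    (b := 1000000031169117998835179 / 10 ^ 24) (e := 1 / 10 ^ 24) <;>
    norm_num [restGradFst, restGradSnd, μES, kES, abs_le]

theorem f_g_P2_mem_Ioo : -f P2 ∈ Set.Ioo (2.22772 / 10 ^ 13 : ℝ) (2.22773 / 10 ^ 13) ∧
    g P2 ∈ Set.Ioo (3.94516 / 10 ^ 13 : ℝ) (3.94517 / 10 ^ 13) := by
  rw [Set.neg_mem_Ioo_iff]
  apply fGen_gGen_mem_Ioo one_div_cES_sq (a := 1000000000000005744897996 / 10 ^ 24)
    (b := 999999956169124098650377 / 10 ^ 24) (e := 1 / 10 ^ 24) <;>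
    norm_num [restGradFst, restGradSnd, μES, kES, abs_le]

theorem f_g_P3_mem_Ioo : f P3 ∈ Set.Ioo (4.60545 / 10 ^ 13 : ℝ) (4.60546 / 10 ^ 13) ∧
    -g P3 ∈ Set.Ioo (7.63052 / 10 ^ 13 : ℝ) (7.63053 / 10 ^ 13) := by
  rw [Set.neg_mem_Ioo_iff]
  apply fGen_gGen_mem_Ioo one_div_cES_sq (a := 1000000000000000746243463 / 10 ^ 24)
    (b := 1000000106169133126102002 / 10 ^ 24) (e := 1 / 10 ^ 24) <;>
    norm_num [restGradFst, restGradSnd, μES, kES, abs_le]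

theorem f_g_P4_mem_Ioo : -f P4 ∈ Set.Ioo (1.12499 / 10 ^ 7 : ℝ) (1.12500 / 10 ^ 7) ∧
    -g P4 ∈ Set.Ioo (1.94855 / 10 ^ 7 : ℝ) (1.94856 / 10 ^ 7) := by
  rw [Set.neg_mem_Ioo_iff, Set.neg_mem_Ioo_iff]
  apply fGen_gGen_mem_Ioo one_div_cES_sq (a := 1000000075000013859113059 / 10 ^ 24)
    (b := 1000000031169122350915695 / 10 ^ 24) (e := 1 / 10 ^ 24) <;>
    norm_num [restGradFst, restGradSnd, μES, kES, abs_le]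

theorem f_g_Z0_mem_Ioo : -f Z0 ∈ Set.Ioo (1.14508 / 10 ^ 32 : ℝ) (1.14509 / 10 ^ 32) ∧
    -g Z0 ∈ Set.Ioo (4.25190 / 10 ^ 32 : ℝ) (4.25191 / 10 ^ 32) := by
  rw [Set.neg_mem_Ioo_iff, Set.neg_mem_Ioo_iff]
  apply fGen_gGen_mem_Ioo one_div_cES_sq
    (a := 10000000000000074120131788952274137983115790044 / 10 ^ 46)
    (b := 10000000061691229411339844611259914943790428090 / 10 ^ 46) (e := 1 / 10 ^ 46) <;>
    norm_num [restGradFst, restGradSnd, μES, kES, abs_le]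

theorem f_g_Q2_mem_Ioo : f Q2 ∈ Set.Ioo (-1 : ℝ) 0 ∧ g Q2 ∈ Set.Ioo (0 : ℝ) 1 := by
  apply fGen_gGen_mem_Ioo one_div_cES_sq (a := 1000000000000007661783934 / 10 ^ 24)
    (b := 1000000005169123156365335 / 10 ^ 24) (e := 1 / 10 ^ 24) <;>
    norm_num [restGradFst, restGradSnd, μES, kES, abs_le]

theorem f_g_Q3_mem_Ioo : f Q3 ∈ Set.Ioo (0 : ℝ) 1 ∧ g Q3 ∈ Set.Ioo (-1 : ℝ) 0 := by
  apply fGen_gGen_mem_Ioo one_div_cES_sq (a := 1000000000000007179082842 / 10 ^ 24)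
    (b := 1000000007169122710678973 / 10 ^ 24) (e := 1 / 10 ^ 24) <;>
    norm_num [restGradFst, restGradSnd, μES, kES, abs_le]

/-! ### The signs on the sides and the location of the equilibrium -/

theorem outwardRectangle_P2_P3 : OutwardRectangle P2 P3 where
  topLeft_mem := by norm_num [P2, ξRange, ηRange]
  bottomRight_mem := by norm_num [P3, ξRange, ηRange]
  fst_le := by norm_num [P2, P3]
  snd_le := by norm_num [P2, P3]
  f_topLeft_neg := neg_pos.1 (lt_trans (by norm_num) f_g_P2_mem_Ioo.1.1)
  g_topLeft_pos := lt_trans (by norm_num) f_g_P2_mem_Ioo.2.1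
  f_bottomRight_pos := lt_trans (by norm_num) f_g_P3_mem_Ioo.1.1
  g_bottomRight_neg := neg_pos.1 (lt_trans (by norm_num) f_g_P3_mem_Ioo.2.1)

theorem outwardRectangle_Q2_Q3 : OutwardRectangle Q2 Q3 where
  topLeft_mem := by norm_num [Q2, ξRange, ηRange]
  bottomRight_mem := by norm_num [Q3, ξRange, ηRange]
  fst_le := by norm_num [Q2, Q3]
  snd_le := by norm_num [Q2, Q3]
  f_topLeft_neg := f_g_Q2_mem_Ioo.1.2
  g_topLeft_pos := f_g_Q2_mem_Ioo.2.1
  f_bottomRight_pos := f_g_Q3_mem_Ioo.1.1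
  g_bottomRight_neg := f_g_Q3_mem_Ioo.2.2

theorem β1_eq (t : ℝ) : β1 t = (t • P3.1 + (1 - t) • P2.1, P2.2) :=
  Prod.ext rfl (Convex.combo_self (add_sub_cancel t 1) _)

theorem β2_eq (t : ℝ) : β2 t = (t • P3.1 + (1 - t) • P2.1, P3.2) :=
  Prod.ext rfl (Convex.combo_self (add_sub_cancel t 1) _)

theorem β3_eq (t : ℝ) : β3 t = (P3.1, t • P2.2 + (1 - t) • P3.2) :=
  Prod.ext (Convex.combo_self (add_sub_cancel t 1) _) rfl

theorem β4_eq (t : ℝ) : β4 t = (P2.1, t • P2.2 + (1 - t) • P3.2) :=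
  Prod.ext (Convex.combo_self (add_sub_cancel t 1) _) rfl

theorem smul_add_one_sub_smul_mem_Icc {a b t : ℝ} (hab : a ≤ b) (ht : t ∈ Set.Icc (0 : ℝ) 1) :
    t • b + (1 - t) • a ∈ Set.Icc a b :=
  convex_Icc a b (Set.right_mem_Icc.2 hab) (Set.left_mem_Icc.2 hab) ht.1 (sub_nonneg.2 ht.2)
    (add_sub_cancel t 1)

section Sides

variable {t : ℝ} (ht : t ∈ Set.Icc (0 : ℝ) 1)

include ht

theorem g_β1_pos : 0 < g (β1 t) := by
  rw [β1_eq]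
  exact outwardRectangle_P2_P3.g_top_pos
    (smul_add_one_sub_smul_mem_Icc outwardRectangle_P2_P3.fst_le ht)

theorem g_β2_neg : g (β2 t) < 0 := by
  rw [β2_eq]
  exact outwardRectangle_P2_P3.g_bottom_neg
    (smul_add_one_sub_smul_mem_Icc outwardRectangle_P2_P3.fst_le ht)

theorem f_β3_pos : 0 < f (β3 t) := by
  rw [β3_eq]
  exact outwardRectangle_P2_P3.f_right_pos
    (smul_add_one_sub_smul_mem_Icc outwardRectangle_P2_P3.snd_le ht)

theorem f_β4_neg : f (β4 t) < 0 := by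
  rw [β4_eq]
  exact outwardRectangle_P2_P3.f_left_neg
    (smul_add_one_sub_smul_mem_Icc outwardRectangle_P2_P3.snd_le ht)

end Sides

theorem region_eq : region = Set.Ioo P2.1 P3.1 ×ˢ Set.Ioo P3.2 P2.2 := by
  have hvertices : ({P1, P2, P3, P4} : Set (ℝ × ℝ)) = {P2.1, P3.1} ×ˢ {P3.2, P2.2} := by
    simp only [Set.insert_prod, Set.singleton_prod, Set.image_pair, P1, P2, P3, P4]
    grind
  rw [region, hvertices, convexHull_prod, convexHull_pair, convexHull_pair,
    segment_eq_Icc outwardRectangle_P2_P3.fst_le, segment_eq_Icc outwardRectangle_P2_P3.snd_le,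
    interior_prod_eq, interior_Icc, interior_Icc]

theorem Q_rectangle_subset_region : Set.Ioo Q2.1 Q3.1 ×ˢ Set.Ioo Q3.2 Q2.2 ⊆ region := by
  rw [region_eq]
  exact Set.prod_mono (Set.Ioo_subset_Ioo (by norm_num [P2, Q2]) (by norm_num [P3, Q3]))
    (Set.Ioo_subset_Ioo (by norm_num [P3, Q3]) (by norm_num [P2, Q2]))

theorem dist_L4_lt {p : ℝ × ℝ} (hp : p ∈ Set.Ioo Q2.1 Q3.1 ×ˢ Set.Ioo Q3.2 Q2.2) :
    Real.sqrt ((p.1 - (1 - 2 * μES) / 2) ^ 2 + (p.2 - Real.sqrt 3 / 2) ^ 2) < 1 / 10 ^ 8 := by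
  obtain ⟨⟨hleft, hright⟩, hbottom, htop⟩ := hp
  norm_num [Q2, Q3] at hleft hright hbottom htop
  have hsqrt3_lower : (1.7320508075 : ℝ) < Real.sqrt 3 := Real.lt_sqrt_of_sq_lt (by norm_num)
  have hsqrt3_upper : Real.sqrt 3 < (1.732050807569 : ℝ) :=
    (Real.sqrt_lt' (by norm_num)).2 (by norm_num)
  have hfst : |p.1 - (1 - 2 * μES) / 2| ≤ 7.2 / 10 ^ 9 := by
    rw [abs_le, μES]
    constructor <;> linarith
  have hsnd : |p.2 - Real.sqrt 3 / 2| ≤ 4.2 / 10 ^ 9 := by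
    rw [abs_le]
    constructor <;> linarith
  rw [Real.sqrt_lt' (by norm_num)]
  calc (p.1 - (1 - 2 * μES) / 2) ^ 2 + (p.2 - Real.sqrt 3 / 2) ^ 2
    _ ≤ (7.2 / 10 ^ 9) ^ 2 + (4.2 / 10 ^ 9) ^ 2 :=
      add_le_add (sq_le_sq.2 (hfst.trans (le_abs_self _))) (sq_le_sq.2 (hsnd.trans (le_abs_self _)))
    _ < (1 / 10 ^ 8) ^ 2 := by norm_num

end RelRTBP

end

theorem mainTheorem1 :
    -- the values of `f` and `g` at the vertices and at `Z0`, to the stated number of digits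
    (RelRTBP.f RelRTBP.P1 ∈ Set.Ico (1.124997 / 10 ^ 7 : ℝ) (1.124998 / 10 ^ 7) ∧
      RelRTBP.g RelRTBP.P1 ∈ Set.Ico (1.94854 / 10 ^ 7 : ℝ) (1.94855 / 10 ^ 7) ∧
      -RelRTBP.f RelRTBP.P2 ∈ Set.Ico (2.22772 / 10 ^ 13 : ℝ) (2.22773 / 10 ^ 13) ∧
      RelRTBP.g RelRTBP.P2 ∈ Set.Ico (3.94516 / 10 ^ 13 : ℝ) (3.94517 / 10 ^ 13) ∧
      RelRTBP.f RelRTBP.P3 ∈ Set.Ico (4.60545 / 10 ^ 13 : ℝ) (4.60546 / 10 ^ 13) ∧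
      -RelRTBP.g RelRTBP.P3 ∈ Set.Ico (7.63052 / 10 ^ 13 : ℝ) (7.63053 / 10 ^ 13) ∧
      -RelRTBP.f RelRTBP.P4 ∈ Set.Ico (1.12499 / 10 ^ 7 : ℝ) (1.12500 / 10 ^ 7) ∧
      -RelRTBP.g RelRTBP.P4 ∈ Set.Ico (1.94855 / 10 ^ 7 : ℝ) (1.94856 / 10 ^ 7) ∧
      -RelRTBP.f RelRTBP.Z0 ∈ Set.Ico (1.14508 / 10 ^ 32 : ℝ) (1.14509 / 10 ^ 32) ∧
      -RelRTBP.g RelRTBP.Z0 ∈ Set.Ico (4.25190 / 10 ^ 32 : ℝ) (4.25191 / 10 ^ 32)) ∧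
    -- the signs on the four sides
    (∀ t ∈ Set.Icc (0 : ℝ) 1, 0 < RelRTBP.g (RelRTBP.β1 t)) ∧
    (∀ t ∈ Set.Icc (0 : ℝ) 1, RelRTBP.g (RelRTBP.β2 t) < 0) ∧
    (∀ t ∈ Set.Icc (0 : ℝ) 1, 0 < RelRTBP.f (RelRTBP.β3 t)) ∧
    (∀ t ∈ Set.Icc (0 : ℝ) 1, RelRTBP.f (RelRTBP.β4 t) < 0) ∧
    -- the equilibrium inside the region, close to the Newtonian `L₄`
    (∃ P₀ ∈ RelRTBP.region, RelRTBP.f P₀ = 0 ∧ RelRTBP.g P₀ = 0 ∧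
      Real.sqrt ((P₀.1 - (1 - 2 * RelRTBP.μES) / 2) ^ 2 + (P₀.2 - Real.sqrt 3 / 2) ^ 2)
        < 1 / 10 ^ 8) := by
  obtain ⟨f1, g1⟩ := RelRTBP.f_g_P1_mem_Ioo
  obtain ⟨f2, g2⟩ := RelRTBP.f_g_P2_mem_Ioo
  obtain ⟨f3, g3⟩ := RelRTBP.f_g_P3_mem_Ioo
  obtain ⟨f4, g4⟩ := RelRTBP.f_g_P4_mem_Ioo
  obtain ⟨f0, g0⟩ := RelRTBP.f_g_Z0_mem_Ioo
  obtain ⟨P, hP, hf, hg⟩ := RelRTBP.outwardRectangle_Q2_Q3.exists_equilibrium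
  have hdigits {x y z : ℝ} (h : z ∈ Set.Ioo x y) : z ∈ Set.Ico x y := Set.Ioo_subset_Ico_self h
  exact ⟨⟨hdigits f1, hdigits g1, hdigits f2, hdigits g2, hdigits f3, hdigits g3,
      hdigits f4, hdigits g4, hdigits f0, hdigits g0⟩,
    fun _ => RelRTBP.g_β1_pos, fun _ => RelRTBP.g_β2_neg,
    fun _ => RelRTBP.f_β3_pos, fun _ => RelRTBP.f_β4_neg,
    P, RelRTBP.Q_rectangle_subset_region hP, hf, hg, RelRTBP.dist_L4_lt hP⟩
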